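/- Let $m \ge 1$, $n_1,\dots,n_m \ge 1$, $n = n_1+\cdots+n_m$ and $t_0 \in \mathbb{R}$. Consider the interconnected nonlinear time-varying system $$\dot x_i = f_i(t, x_1,\dots,x_m), \qquad t \ge t_0,\quad i \in \{1,\dots,m\},$$ with $x_i \in \mathbb{R}^{n_i}$, $x = (x_1,\dots,x_m) \in \mathbb{R}^n$ and $f = (f_1,\dots,f_m)$. Assume that $f(t,x)$ is piecewise continuous in $t$ (with breakpoints that do not depend on $x$ and do not accumulate, and jointly continuous in $(t,x)$ up to the breakpoints between consecutive ones), that it is continuously differentiable in $x$ with a Jacobian matrix that is bounded on compact sets of $(t,x) \in [t_0,\infty) \times \mathbb{R}^n$ (as when the Jacobian is piecewise continuous in $t$ as well), and that for each $x \in \mathbb{R}^n$ the solution $t \mapsto \xi(t,t_0,x)$ with initial state $x$ at time $t_0$ exists on $[t_0,\infty)$. Let $K \subset \mathbb{R}^n$ be compact with nonempty interior, let $\xi(t,t_0,K) = \{\xi(t,t_0,x) : x \in K\}$ be the reachable set, let $|\cdot|$ be any norm on $\mathbb{R}^n$, and let $S(f,t_0,\varepsilon,T,K)$ be the minimal cardinality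 of a set $E \subset K$ such that for every $\bar x \in K$ there is $x \in E$ with $|\xi(t,t_0,\bar x) - \xi(t,t_0,x)| < \varepsilon$ for all $t \in [t_0,t_0+T]$. The topological entropy is $$h(f,t_0,K) = \lim_{\varepsilon \searrow 0}\, \limsup_{T\to\infty} \frac1T \log S(f,t_0,\varepsilon,T,K) \in [0,\infty].$$ Let $|\cdot|_i$ be a norm on $\mathbb{R}^{n_i}$ for each $i$, and let $|\cdot|_{\mathrm N}$ be a norm on $\mathbb{R}^m$ that is monotone: $v \ge w$ entrywise implies $|v|_{\mathrm N} \ge |w|_{\mathrm N}$ for all entrywise nonnegative $v, w \in \mathbb{R}^m$. Let $\mu_i$ and $\mu_{\mathrm N}$ be the corresponding matrix measures, where the matrix measure for an induced matrix norm $\|\cdot\|$ is $\mu(A) = \lim_{s \searrow 0} (\|I + sA\| - 1)/s$, and let $\|A\|_{ij} = \max_{|v|_j = 1} |Av|_i$ for $A \in \mathbb{R}^{n_i \times n_j}$. Define the interconnection matrix $A_{\mathrm N}(t,x) = [a_{ij}(t,x)] \in \mathbb{R}^{m\times m}$ by $$a_{ii}(t,x) = \mu_i\!\left(\frac{\partial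 f_i}{\partial x_i}(t,x)\right), \qquad a_{ij}(t,x) = \left\|\frac{\partial f_i}{\partial x_j}(t,x)\right\|_{ij} \quad (i \ne j).$$ Then $$h(f,t_0,K) \le n \max\{\hat\mu_{\mathrm N}, 0\}, \qquad \hat\mu_{\mathrm N} := \limsup_{t\to\infty}\ \max_{v \in \mathrm{co}(\xi(t,t_0,K))} \mu_{\mathrm N}(A_{\mathrm N}(t,v)) \in [-\infty,\infty],$$ where $\mathrm{co}$ denotes the convex hull. -/

import Mathlib

open Set Filter Topology

noncomputable section

namespace InterEntropy

/-! ### Norms, induced norms and matrix measures -/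

/-- A seminorm on a real vector space is a norm if it vanishes only at the origin. -/
def IsNorm {V : Type*} [AddCommGroup V] [Module ℝ V] (p : Seminorm ℝ V) : Prop :=
  ∀ v, p v = 0 → v = 0

/-- A norm on `ℝ^m` is monotone if `v ≥ w` implies `|v| ≥ |w|` for entrywise nonnegative
vectors `v`, `w`. -/
def IsMonotone {m : ℕ} (p : Seminorm ℝ (Fin m → ℝ)) : Prop :=
  ∀ v w : Fin m → ℝ, 0 ≤ v → 0 ≤ w → w ≤ v → p w ≤ p v

/-- The (mixed) induced norm `max_{|v|_p = 1} |A v|_q` of a matrix `A`, for norms `p` on the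
domain and `q` on the codomain. -/
def inducedNorm {k l : ℕ} (p : Seminorm ℝ (Fin l → ℝ)) (q : Seminorm ℝ (Fin k → ℝ))
    (A : Matrix (Fin k) (Fin l) ℝ) : ℝ :=
  sSup {r : ℝ | ∃ v : Fin l → ℝ, p v = 1 ∧ r = q (A.mulVec v)}

/-- The matrix measure (logarithmic norm) `lim_{s ↘ 0} (‖I + s A‖ - 1) / s` of a square matrix,
where `‖·‖` is the norm on matrices induced by the norm `p`. -/
def matrixMeasure {k : ℕ} (p : Seminorm ℝ (Fin k → ℝ)) (A : Matrix (Fin k) (Fin k) ℝ) : ℝ :=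
  limUnder (𝓝[>] (0 : ℝ)) fun s : ℝ => (inducedNorm p p (1 + s • A) - 1) / s

theorem bddAbove_inducedNorm {k l : ℕ} {p : Seminorm ℝ (Fin l → ℝ)} (hp : IsNorm p)
    (q : Seminorm ℝ (Fin k → ℝ)) (A : Matrix (Fin k) (Fin l) ℝ) :
    BddAbove {r : ℝ | ∃ v : Fin l → ℝ, p v = 1 ∧ r = q (A.mulVec v)} := by
  have hpc : Continuous p := continuousOn_univ.1 (p.convexOn.continuousOn isOpen_univ)
  have hqc : Continuous q := continuousOn_univ.1 (q.convexOn.continuousOn isOpen_univ)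
  have hqA : Continuous fun v : Fin l → ℝ => q (A.mulVec v) :=
    hqc.comp (Continuous.matrix_mulVec continuous_const continuous_id)
  obtain ⟨M, hM⟩ := (isCompact_sphere (0 : Fin l → ℝ) 1).bddAbove_image hqA.continuousOn
  rcases (Metric.sphere (0 : Fin l → ℝ) 1).eq_empty_or_nonempty with he | hne
  · refine ⟨0, ?_⟩
    rintro r ⟨v, hv, rfl⟩
    exfalso
    have hv0 : v ≠ 0 := by rintro rfl; simp at hv
    have : (‖v‖⁻¹ • v) ∈ Metric.sphere (0 : Fin l → ℝ) 1 := by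
      simp [norm_smul, hv0]
    rw [he] at this
    exact this
  obtain ⟨u, hu, hmin⟩ := (isCompact_sphere (0 : Fin l → ℝ) 1).exists_isMinOn hne hpc.continuousOn
  have hu0 : u ≠ 0 := by rintro rfl; simp at hu
  have hc : 0 < p u := lt_of_le_of_ne (apply_nonneg p u) fun h => hu0 (hp u h.symm)
  have hM0 : 0 ≤ M := (apply_nonneg q _).trans (hM ⟨u, hu, rfl⟩)
  refine ⟨M / p u, ?_⟩
  rintro r ⟨v, hv, rfl⟩
  have hv0 : v ≠ 0 := by rintro rfl; simp at hv
  have hnv : 0 < ‖v‖ := norm_pos_iff.2 hv0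
  have hw : (‖v‖⁻¹ • v) ∈ Metric.sphere (0 : Fin l → ℝ) 1 := by
    simp [norm_smul, hv0]
  have h1 : p u ≤ ‖v‖⁻¹ := by
    have := hmin hw
    simpa [map_smul_eq_mul, hv] using this
  have h2 : ‖v‖⁻¹ * q (A.mulVec v) ≤ M := by
    have := hM ⟨_, hw, rfl⟩
    simpa [Matrix.mulVec_smul, map_smul_eq_mul] using this
  rw [le_div_iff₀ hc]
  have := apply_nonneg q (A.mulVec v)
  nlinarith

/-- For a norm on `ℝ^k`, `k ≥ 1`, the limit that defines the matrix measure exists. -/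
theorem tendsto_matrixMeasure {k : ℕ} (hk : 1 ≤ k) {p : Seminorm ℝ (Fin k → ℝ)} (hp : IsNorm p)
    (A : Matrix (Fin k) (Fin k) ℝ) :
    Tendsto (fun s : ℝ => (inducedNorm p p (1 + s • A) - 1) / s) (𝓝[>] 0)
      (𝓝 (matrixMeasure p A)) := by
  obtain ⟨e, he⟩ : ∃ e : Fin k → ℝ, p e = 1 := by
    let u : Fin k → ℝ := fun _ => 1
    have hu : p u ≠ 0 := fun h => by
      have := congrFun (hp u h) ⟨0, hk⟩
      simp [u] at this
    exact ⟨(p u)⁻¹ • u, by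
      rw [map_smul_eq_mul, norm_inv, Real.norm_of_nonneg (apply_nonneg p u), inv_mul_cancel₀ hu]⟩
  have hle : ∀ (B : Matrix (Fin k) (Fin k) ℝ) v, p v = 1 → p (B.mulVec v) ≤ inducedNorm p p B :=
    fun B v hv => le_csSup (bddAbove_inducedNorm hp p B) ⟨v, hv, rfl⟩
  have hge : ∀ (B : Matrix (Fin k) (Fin k) ℝ) c, (∀ v, p v = 1 → p (B.mulVec v) ≤ c) →
      inducedNorm p p B ≤ c := by
    intro B c h
    refine csSup_le ⟨_, e, he, rfl⟩ ?_
    rintro r ⟨v, hv, rfl⟩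
    exact h v hv
  have hmono : MonotoneOn (fun s : ℝ => (inducedNorm p p (1 + s • A) - 1) / s) (Ioi 0) := by
    intro s hs r hr hsr
    simp only [mem_Ioi] at hs hr
    have hsr1 : s / r ≤ 1 := (div_le_one hr).2 hsr
    have key : inducedNorm p p (1 + s • A) ≤
        (1 - s / r) + s / r * inducedNorm p p (1 + r • A) := by
      refine hge _ _ fun v hv => ?_
      have e1 : (1 + s • A).mulVec v =
          (1 - s / r) • v + (s / r) • (1 + r • A).mulVec v := by
        simp only [Matrix.add_mulVec, Matrix.one_mulVec, Matrix.smul_mulVec, smul_add, smul_smul]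
        rw [div_mul_cancel₀ _ hr.ne', sub_smul, one_smul]
        abel
      rw [e1]
      refine (map_add_le_add p _ _).trans ?_
      rw [map_smul_eq_mul, map_smul_eq_mul, Real.norm_of_nonneg (by linarith),
        Real.norm_of_nonneg (by positivity), hv, mul_one]
      have := hle (1 + r • A) v hv
      gcongr
    show _ / s ≤ _ / r
    rw [div_le_iff₀ hs]
    calc _ ≤ s / r * (inducedNorm p p (1 + r • A) - 1) := by linarith
      _ = _ := by ring
  have hbdd : BddBelow ((fun s : ℝ => (inducedNorm p p (1 + s • A) - 1) / s) '' Ioi 0) := by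
    refine ⟨-p (A.mulVec e), ?_⟩
    rintro _ ⟨s, hs, rfl⟩
    simp only [mem_Ioi] at hs
    have h1 := hle (1 + s • A) e he
    have h2 : p e ≤ p ((1 + s • A).mulVec e) + s * p (A.mulVec e) := by
      have e1 : e = (1 + s • A).mulVec e - s • A.mulVec e := by
        simp [Matrix.add_mulVec, Matrix.smul_mulVec]
      calc p e = p ((1 + s • A).mulVec e - s • A.mulVec e) := by rw [← e1]
        _ ≤ _ := map_sub_le_add p _ _
        _ = _ := by rw [map_smul_eq_mul, Real.norm_of_nonneg hs.le]
    show _ ≤ _ / s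
    rw [le_div_iff₀ hs]
    linarith
  exact tendsto_nhds_limUnder ⟨_, hmono.tendsto_nhdsGT hbdd⟩

/-! ### Time-varying systems and their solutions -/

/-- The state space `ℝ^{n_1} × ⋯ × ℝ^{n_m}`; its instance norm is only used for its topology,
for derivatives and for integrals. -/
abbrev State {m : ℕ} (n : Fin m → ℕ) : Type := (i : Fin m) → Fin (n i) → ℝ

/-- `g(t, x)`, `t ≥ t₀`, is piecewise continuous in `t` and continuous in `x`: there are times
`t₀ = τ_0 < τ_1 < ⋯` tending to infinity such that on each `(τ_k, τ_{k+1}) × X` the function `g`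
agrees with a function that is continuous on `[τ_k, τ_{k+1}] × X`. (The values of `g` at the
times `τ_k` are not restricted, and `τ_k` need not be a discontinuity.) -/
def PiecewiseContinuous {X Y : Type*} [TopologicalSpace X] [TopologicalSpace Y]
    (t₀ : ℝ) (g : ℝ → X → Y) : Prop :=
  ∃ τ : ℕ → ℝ, τ 0 = t₀ ∧ StrictMono τ ∧ Tendsto τ atTop atTop ∧
    ∀ k, ∃ G : ℝ × X → Y, ContinuousOn G (Icc (τ k) (τ (k + 1)) ×ˢ univ) ∧
      ∀ t ∈ Ioo (τ k) (τ (k + 1)), ∀ x, g t x = G (t, x)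

/-- Regularity of the right-hand side of `ẋ = f(t, x)`, `t ≥ t₀`: piecewise continuous in `t`,
continuously differentiable in `x`, with a Jacobian that is bounded on bounded time intervals and
compact sets of states (as is the case when the Jacobian is piecewise continuous in `t` too; this
is what makes solutions unique). -/
structure IsRegular {X : Type*} [NormedAddCommGroup X] [NormedSpace ℝ X]
    (t₀ : ℝ) (f : ℝ → X → X) : Prop where
  piecewise : PiecewiseContinuous t₀ f
  contDiff : ∀ t, t₀ ≤ t → ContDiff ℝ 1 (f t)
  bounded_fderiv : ∀ (t₁ : ℝ) (C : Set X), IsCompact C →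
    ∃ L : ℝ, ∀ t ∈ Icc t₀ t₁, ∀ x ∈ C, ‖fderiv ℝ (f t) x‖ ≤ L

/-- `φ` is a solution of `ẋ = f(t, x)`, `t ≥ t₀`, with `φ(t₀) = x` (in integral form, that is, `φ`
is locally absolutely continuous and satisfies the equation almost everywhere). -/
def IsSolution {X : Type*} [NormedAddCommGroup X] [NormedSpace ℝ X]
    (f : ℝ → X → X) (t₀ : ℝ) (x : X) (φ : ℝ → X) : Prop :=
  ContinuousOn φ (Ici t₀) ∧
    ∀ t, t₀ ≤ t → IntervalIntegrable (fun s => f s (φ s)) MeasureTheory.volume t₀ t ∧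
      φ t = x + ∫ s in t₀..t, f s (φ s)

/-- Every initial state at time `t₀` has a solution on the whole of `[t₀, ∞)`. -/
def IsForwardComplete {X : Type*} [NormedAddCommGroup X] [NormedSpace ℝ X]
    (f : ℝ → X → X) (t₀ : ℝ) : Prop :=
  ∀ x, ∃ φ, IsSolution f t₀ x φ

open Classical in
/-- The solution `ξ(t, t₀, x)` at time `t` with initial state `x` at time `t₀`. -/
def flow {X : Type*} [NormedAddCommGroup X] [NormedSpace ℝ X]
    (f : ℝ → X → X) (t t₀ : ℝ) (x : X) : X :=
  if h : ∃ φ, IsSolution f t₀ x φ then h.choose t else x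

/-- The reachable set `ξ(t, t₀, K)`. -/
def reachableSet {X : Type*} [NormedAddCommGroup X] [NormedSpace ℝ X]
    (f : ℝ → X → X) (t t₀ : ℝ) (K : Set X) : Set X :=
  (fun x => flow f t t₀ x) '' K

/-! ### Topological entropy -/

section Entropy

variable {X : Type*} [NormedAddCommGroup X] [NormedSpace ℝ X]

/-- `E ⊆ K` is `(T, ε)`-spanning for `K` at initial time `t₀`, with respect to the norm `p`. -/
def IsSpanning (p : Seminorm ℝ X) (f : ℝ → X → X) (t₀ ε T : ℝ) (K : Set X)
    (E : Finset X) : Prop :=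
  (E : Set X) ⊆ K ∧
    ∀ y ∈ K, ∃ x ∈ E, ∀ t ∈ Icc t₀ (t₀ + T), p (flow f t t₀ y - flow f t t₀ x) < ε

/-- The minimal cardinality `S(f, t₀, ε, T, K)` of a `(T, ε)`-spanning set. -/
def spanNumber (p : Seminorm ℝ X) (f : ℝ → X → X) (t₀ ε T : ℝ) (K : Set X) : ℕ∞ :=
  ⨅ (E : Finset X) (_ : IsSpanning p f t₀ ε T K E), (E.card : ℕ∞)

/-- `limsup_{T → ∞} (1 / T) log S(f, t₀, ε, T, K)`. -/
def spanGrowth (p : Seminorm ℝ X) (f : ℝ → X → X) (t₀ ε : ℝ) (K : Set X) : EReal :=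
  limsup (fun T : ℝ => ENNReal.log (spanNumber p f t₀ ε T K : ENNReal) / (T : EReal)) atTop

/-- The topological entropy `h(f, t₀, K)`: the limit of `spanGrowth` as `ε ↘ 0`, which is its
supremum over `ε > 0` as it is nonincreasing in `ε` (see `tendsto_spanGrowth`). -/
def entropy (p : Seminorm ℝ X) (f : ℝ → X → X) (t₀ : ℝ) (K : Set X) : EReal :=
  ⨆ (ε : ℝ) (_ : 0 < ε), spanGrowth p f t₀ ε K

theorem spanGrowth_antitone (p : Seminorm ℝ X) (f : ℝ → X → X) (t₀ : ℝ) (K : Set X) :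
    Antitone fun ε => spanGrowth p f t₀ ε K := by
  intro a b hab
  refine limsup_le_limsup ?_
  filter_upwards [eventually_gt_atTop (0 : ℝ)] with T hT
  refine EReal.div_le_div_right_of_nonneg (by exact_mod_cast hT.le) ?_
  refine ENNReal.log_monotone ?_
  have : spanNumber p f t₀ b T K ≤ spanNumber p f t₀ a T K := by
    refine le_iInf₂ fun E hE => iInf₂_le E ⟨hE.1, fun y hy => ?_⟩
    obtain ⟨x, hx, h⟩ := hE.2 y hy
    exact ⟨x, hx, fun t ht => (h t ht).trans_le hab⟩
  exact_mod_cast this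

theorem tendsto_spanGrowth (p : Seminorm ℝ X) (f : ℝ → X → X) (t₀ : ℝ) (K : Set X) :
    Tendsto (fun ε => spanGrowth p f t₀ ε K) (𝓝[>] 0) (𝓝 (entropy p f t₀ K)) := by
  have h := (spanGrowth_antitone p f t₀ K).tendsto_nhdsGT 0
  rw [sSup_image] at h
  exact h

end Entropy

/-! ### The interconnection matrix function -/

/-- The Jacobian matrix of `f_i(t, x)` with respect to `x_j`, evaluated at `x = v`. -/
def jacobianBlock {m : ℕ} {n : Fin m → ℕ} (f : ℝ → State n → State n) (t : ℝ) (v : State n)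
    (i j : Fin m) : Matrix (Fin (n i)) (Fin (n j)) ℝ :=
  Matrix.of fun a b => fderiv ℝ (f t) v (Pi.single j (Pi.single b 1)) i a

/-- The interconnection matrix `A_N(t, v)` for the local norms `pL i` on `ℝ^{n_i}`: matrix
measures of the diagonal Jacobian blocks, induced norms of the off-diagonal ones. -/
def interMatrix {m : ℕ} {n : Fin m → ℕ} (pL : (i : Fin m) → Seminorm ℝ (Fin (n i) → ℝ))
    (f : ℝ → State n → State n) (t : ℝ) (v : State n) : Matrix (Fin m) (Fin m) ℝ :=
  Matrix.of fun i j =>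
    if i = j then matrixMeasure (pL i) (jacobianBlock f t v i i)
    else inducedNorm (pL j) (pL i) (jacobianBlock f t v i j)

/-- The constant `limsup_{t → ∞} max_{v ∈ co(ξ(t, t₀, K))} μ_N(A_N(t, v))`, an extended real
number. -/
def muHat {m : ℕ} {n : Fin m → ℕ} (pL : (i : Fin m) → Seminorm ℝ (Fin (n i) → ℝ))
    (pN : Seminorm ℝ (Fin m → ℝ)) (f : ℝ → State n → State n) (t₀ : ℝ)
    (K : Set (State n)) : EReal :=
  limsup (fun t : ℝ => ⨆ v ∈ convexHull ℝ (reachableSet f t t₀ K),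
    ((matrixMeasure pN (interMatrix pL f t v) : ℝ) : EReal)) atTop

end InterEntropy

end

/-!
Let `q` be the network norm `|(|x_1|_1, …, |x_m|_m)|_N`. Its one-sided directional derivative at
`w` in the direction `J w`, for a Jacobian `J` of `f`, is at most `μ_N(A_N) * q w`: blockwise,
`|w_i|_i` grows at a rate of at most `∑ j, a_ij |w_j|_j`, and monotonicity of `|·|_N` passes this on
to `q`. By convexity of the directional derivative in the direction, the mean value theorem turns
this into the same bound for the difference of two solutions from `K`, with `μ_N(A_N)` taken on the
segment between them, hence in the convex hull of the reachable set. So for every real `c` above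
both `muHat` and `0`, the solutions from `K` diverge at most like `e^{ct}` once a transient has
passed, and over a time `T` it suffices to cover `K` by balls of radius `r ∼ e^{-cT}`. Comparing
volumes, `O(r^{-n})` of them are enough, which gives the growth rate `n c`.
-/

noncomputable section

namespace InterEntropy

theorem rightDeriv_le_of_eventually_le {f g : ℝ → ℝ} {a f' g' : ℝ}
    (hf : HasDerivWithinAt f f' (Ioi a) a) (hg : HasDerivWithinAt g g' (Ioi a) a)
    (ha : f a = g a) (h : ∀ᶠ s in 𝓝[>] a, f s ≤ g s) : f' ≤ g' := by
  rw [hasDerivWithinAt_iff_tendsto_slope' (notMem_Ioi.2 le_rfl)] at hf hg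
  refine le_of_tendsto_of_tendsto hf hg ?_
  filter_upwards [h, self_mem_nhdsWithin] with s hs has
  rw [slope_def_field, slope_def_field, ha]
  exact div_le_div_of_nonneg_right (by linarith) (sub_nonneg.2 (le_of_lt has))

section DirDeriv

variable {X : Type*} [AddCommGroup X] [Module ℝ X] (q : Seminorm ℝ X) (x : X)

/-- The one-sided directional derivative of the seminorm `q` at `x` in the direction `w`. -/
def dirDeriv (w : X) : ℝ :=
  derivWithin (fun s : ℝ => q (x + s • w)) (Ioi 0) 0

theorem hasDerivWithinAt_dirDeriv (w : X) :
    HasDerivWithinAt (fun s : ℝ => q (x + s • w)) (dirDeriv q x w) (Ioi 0) 0 := by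
  have hconv : ConvexOn ℝ univ fun s : ℝ => q (x + s • w) :=
    (q.convexOn.translate_right x).comp_linearMap (LinearMap.toSpanSingleton ℝ X w)
  exact hconv.hasDerivWithinAt_rightDeriv_of_mem_interior (by rw [interior_univ]; trivial)

theorem dirDeriv_zero : dirDeriv q x 0 = 0 := by
  simp [dirDeriv]

theorem dirDeriv_add_le (w w' : X) : dirDeriv q x (w + w') ≤ dirDeriv q x w + q w' := by
  have hlin : HasDerivWithinAt (fun s : ℝ => s * q w') (q w') (Ioi 0) 0 := by
    simpa using (hasDerivWithinAt_id (0 : ℝ) (Ioi 0)).mul_const (q w')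
  refine rightDeriv_le_of_eventually_le (hasDerivWithinAt_dirDeriv q x _)
    ((hasDerivWithinAt_dirDeriv q x w).add hlin) (by simp) ?_
  filter_upwards [self_mem_nhdsWithin] with s hs
  calc q (x + s • (w + w')) = q ((x + s • w) + s • w') := by congr 1; module
    _ ≤ q (x + s • w) + q (s • w') := map_add_le_add q _ _
    _ = q (x + s • w) + s * q w' := by
        rw [map_smul_eq_mul, Real.norm_of_nonneg (le_of_lt hs)]

theorem dirDeriv_le (w : X) : dirDeriv q x w ≤ q w := by
  simpa [dirDeriv_zero] using dirDeriv_add_le q x 0 w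

theorem convexOn_dirDeriv : ConvexOn ℝ univ (dirDeriv q x) := by
  refine ⟨convex_univ, fun w _ w' _ a b ha hb hab => ?_⟩
  refine rightDeriv_le_of_eventually_le (hasDerivWithinAt_dirDeriv q x _)
    (((hasDerivWithinAt_dirDeriv q x w).const_mul a).add
      ((hasDerivWithinAt_dirDeriv q x w').const_mul b))
    (by simp [← add_mul, hab]) (Eventually.of_forall fun s => ?_)
  have hcomb : x + s • (a • w + b • w') = a • (x + s • w) + b • (x + s • w') := by
    calc x + s • (a • w + b • w') = (a + b) • x + s • (a • w + b • w') := by rw [hab, one_smul]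
      _ = a • (x + s • w) + b • (x + s • w') := by module
  rw [hcomb]
  exact q.convexOn.2 (mem_univ _) (mem_univ _) ha hb hab

end DirDeriv

theorem continuous_seminorm {X : Type*} [NormedAddCommGroup X] [NormedSpace ℝ X]
    [FiniteDimensional ℝ X] (q : Seminorm ℝ X) : Continuous q :=
  continuousOn_univ.1 (q.convexOn.continuousOn isOpen_univ)

theorem exists_seminorm_le_mul_norm {X : Type*} [NormedAddCommGroup X] [NormedSpace ℝ X]
    [FiniteDimensional ℝ X] (q : Seminorm ℝ X) : ∃ C, 0 < C ∧ ∀ x, q x ≤ C * ‖x‖ :=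
  q.bound_of_continuous_normedSpace (continuous_seminorm q)

theorem hasDerivWithinAt_seminorm_comp {X : Type*} [NormedAddCommGroup X] [NormedSpace ℝ X]
    [FiniteDimensional ℝ X] (q : Seminorm ℝ X) {γ : ℝ → X} {w : X} {t : ℝ}
    (hγ : HasDerivWithinAt γ w (Ioi t) t) :
    HasDerivWithinAt (fun s => q (γ s)) (dirDeriv q (γ t) w) (Ioi t) t := by
  obtain ⟨C, -, hC⟩ := exists_seminorm_le_mul_norm q
  have htangent : HasDerivWithinAt (fun s => q (γ t + (s - t) • w)) (dirDeriv q (γ t) w)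
      (Ioi t) t := by
    have hshift : HasDerivWithinAt (fun s => s - t) 1 (Ioi t) t :=
      (hasDerivWithinAt_id t _).sub_const t
    simpa [Function.comp_def] using (hasDerivWithinAt_dirDeriv q (γ t) w).comp_of_eq t hshift
      (fun s hs => sub_pos.2 (mem_Ioi.1 hs)) (sub_self t).symm
  have hdiff : HasDerivWithinAt (fun s => q (γ s) - q (γ t + (s - t) • w)) 0 (Ioi t) t := by
    rw [hasDerivWithinAt_iff_isLittleO] at hγ ⊢
    refine (Asymptotics.IsBigO.of_bound C (Eventually.of_forall fun s => ?_)).trans_isLittleO hγ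
    rw [sub_self, zero_smul, add_zero, sub_self, sub_zero, smul_zero, sub_zero, sub_sub]
    exact (abs_sub_map_le_sub q _ _).trans (hC _)
  simpa only [zero_add, sub_add_cancel] using hdiff.fun_add htangent

theorem image_sub_mem_of_fderiv_mem {X Y : Type*} [NormedAddCommGroup X] [NormedSpace ℝ X]
    [NormedAddCommGroup Y] [NormedSpace ℝ Y] {F : X → Y} (hF : Differentiable ℝ F) {S : Set Y}
    (hS : Convex ℝ S) (hSc : IsClosed S) {x y : X}
    (h : ∀ v ∈ segment ℝ x y, fderiv ℝ F v (y - x) ∈ S) : F y - F x ∈ S := by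
  by_contra hnot
  obtain ⟨l, u, hlS, hlu⟩ := geometric_hahn_banach_closed_point hS hSc hnot
  obtain ⟨z, hz, hmvt⟩ := domain_mvt (f := fun v => l (F v))
    (fun v _ => (l.hasFDerivAt.comp v (hF v).hasFDerivAt).hasFDerivWithinAt) convex_univ
    (mem_univ x) (mem_univ y)
  rw [map_sub, hmvt] at hlu
  exact (hlS _ (h z hz)).not_gt hlu

theorem dirDeriv_image_sub_le {X : Type*} [NormedAddCommGroup X] [NormedSpace ℝ X]
    [FiniteDimensional ℝ X] (q : Seminorm ℝ X) {F : X → X} (hF : Differentiable ℝ F) {x y : X}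
    {C : ℝ} (h : ∀ v ∈ segment ℝ x y, dirDeriv q (y - x) (fderiv ℝ F v (y - x)) ≤ C) :
    dirDeriv q (y - x) (F y - F x) ≤ C := by
  have hconv := convexOn_dirDeriv q (y - x)
  have hcont : Continuous (dirDeriv q (y - x)) :=
    continuousOn_univ.1 (hconv.continuousOn isOpen_univ)
  have hS : Convex ℝ {w | dirDeriv q (y - x) w ≤ C} := by simpa using hconv.convex_le C
  exact image_sub_mem_of_fderiv_mem hF hS (isClosed_le hcont continuous_const) h

section Comparison

open MeasureTheory

theorem absolutelyContinuousOnInterval_of_dist_le {X Y : Type*} [PseudoMetricSpace X]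
    [PseudoMetricSpace Y] {f : ℝ → X} {g : ℝ → Y} {a b C : ℝ}
    (hg : AbsolutelyContinuousOnInterval g a b)
    (h : ∀ s ∈ uIcc a b, ∀ t ∈ uIcc a b, dist (f s) (f t) ≤ C * dist (g s) (g t)) :
    AbsolutelyContinuousOnInterval f a b := by
  refine squeeze_zero' (Eventually.of_forall fun E => Finset.sum_nonneg fun _ _ => dist_nonneg)
    ?_ (by simpa only [mul_zero] using Tendsto.const_mul C hg)
  filter_upwards [mem_inf_of_right (mem_principal_self _)] with E hE
  rw [Finset.mul_sum]
  exact Finset.sum_le_sum fun i hi => h _ (hE.1 i hi).1 _ (hE.1 i hi).2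

theorem absolutelyContinuousOnInterval_seminorm_integral {X : Type*} [NormedAddCommGroup X]
    [NormedSpace ℝ X] [FiniteDimensional ℝ X] (q : Seminorm ℝ X) {w : ℝ → X} {a b : ℝ}
    (hw : IntervalIntegrable w volume a b) (x : X) :
    AbsolutelyContinuousOnInterval (fun t => q (x + ∫ s in a..t, w s)) a b := by
  obtain ⟨C, hC, hqC⟩ := exists_seminorm_le_mul_norm q
  refine absolutelyContinuousOnInterval_of_dist_le (C := C)
    (hw.norm.absolutelyContinuousOnInterval_intervalIntegral (c := a) left_mem_uIcc) ?_
  intro s hs t ht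
  have hws := hw.mono_set (uIcc_subset_uIcc_left hs)
  have hwt := hw.mono_set (uIcc_subset_uIcc_left ht)
  calc dist (q (x + ∫ r in a..s, w r)) (q (x + ∫ r in a..t, w r))
      ≤ q ((x + ∫ r in a..s, w r) - (x + ∫ r in a..t, w r)) := abs_sub_map_le_sub q _ _
    _ = q (∫ r in t..s, w r) := by
        rw [add_sub_add_left_eq_sub, intervalIntegral.integral_interval_sub_left hws hwt]
    _ ≤ C * ‖∫ r in t..s, w r‖ := hqC _
    _ ≤ C * |∫ r in t..s, ‖w r‖| := by
        gcongr
        exact intervalIntegral.norm_integral_le_abs_integral_norm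
    _ = C * dist (∫ r in a..s, ‖w r‖) (∫ r in a..t, ‖w r‖) := by
        rw [Real.dist_eq, intervalIntegral.integral_interval_sub_left hws.norm hwt.norm]

theorem le_mul_exp_of_ae_deriv_le {u : ℝ → ℝ} {a b c : ℝ} (hab : a ≤ b)
    (hu : AbsolutelyContinuousOnInterval u a b)
    (h : ∀ᵐ t, t ∈ Icc a b → deriv u t ≤ c * u t) : u b ≤ u a * Real.exp (c * (b - a)) := by
  have hexp : AbsolutelyContinuousOnInterval (fun t => Real.exp (-(c * (t - a)))) a b :=
    ContDiffOn.absolutelyContinuousOnInterval (by fun_prop)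
  have hneg : 0 ≤ᵐ[volume.restrict (Icc a b)]
      fun t => -deriv (fun s => u s * Real.exp (-(c * (s - a)))) t := by
    rw [EventuallyLE, ae_restrict_iff' measurableSet_Icc]
    filter_upwards [h, hu.ae_differentiableAt] with t ht hdiff htab
    have hderiv : HasDerivAt (fun s => u s * Real.exp (-(c * (s - a))))
        (deriv u t * Real.exp (-(c * (t - a))) +
          u t * (Real.exp (-(c * (t - a))) * -(c * 1))) t :=
      (hdiff (uIcc_of_le hab ▸ htab)).hasDerivAt.mul
        (((hasDerivAt_id t).sub_const a).const_mul c).neg.exp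
    rw [hderiv.deriv, Pi.zero_apply]
    nlinarith [ht htab, Real.exp_pos (-(c * (t - a)))]
  have hint := intervalIntegral.integral_nonneg_of_ae_restrict hab hneg
  rw [intervalIntegral.integral_neg, (hu.fun_mul hexp).integral_deriv_eq_sub, sub_self, mul_zero,
    neg_zero, Real.exp_zero, mul_one] at hint
  calc u b = u b * Real.exp (-(c * (b - a))) * Real.exp (c * (b - a)) := by
        rw [mul_assoc, ← Real.exp_add, neg_add_cancel, Real.exp_zero, mul_one]
    _ ≤ u a * Real.exp (c * (b - a)) := by gcongr; linarith

theorem seminorm_add_integral_le {X : Type*} [NormedAddCommGroup X] [NormedSpace ℝ X]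
    [FiniteDimensional ℝ X] (q : Seminorm ℝ X) {δ w : ℝ → X} {a b c : ℝ} (hab : a ≤ b)
    (hw : IntervalIntegrable w volume a b) (hδ : ∀ t ∈ Icc a b, δ t = δ a + ∫ s in a..t, w s)
    (h : ∀ t ∈ Ioo a b, dirDeriv q (δ t) (w t) ≤ c * q (δ t)) :
    q (δ b) ≤ q (δ a) * Real.exp (c * (b - a)) := by
  have hac := absolutelyContinuousOnInterval_seminorm_integral q hw (δ a)
  have key := le_mul_exp_of_ae_deriv_le (c := c) hab hac ?_
  · simpa [← hδ b ⟨hab, le_rfl⟩] using key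
  have hne (r : ℝ) : ∀ᵐ t, t ≠ r := by simp [ae_iff]
  filter_upwards [hac.ae_differentiableAt, hw.ae_hasDerivAt_integral, hne a, hne b]
    with t hdiff hderiv hta htb ht
  have hu := uIcc_of_le hab ▸ ht
  have hright := hasDerivWithinAt_seminorm_comp q
    ((hderiv hu a left_mem_uIcc).const_add (δ a)).hasDerivWithinAt
  rw [(uniqueDiffWithinAt_Ioi t).eq_deriv _ (hdiff hu).hasDerivAt.hasDerivWithinAt hright,
    ← hδ t ht]
  exact h t ⟨lt_of_le_of_ne ht.1 hta.symm, lt_of_le_of_ne ht.2 htb⟩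

end Comparison

section Flow

variable {X : Type*} [NormedAddCommGroup X] [NormedSpace ℝ X] {f : ℝ → X → X} {t₀ : ℝ}

/-- The right-hand side `f` of `ẋ = f(t, x)`, `t ≥ t₀`, is differentiable in `x`, with a derivative
that is bounded on bounded time intervals and compact sets of states: the part of `IsRegular` that
concerns the dependence on the state, and what makes solutions close to each other diverge at a
locally bounded rate. -/
structure HasLocallyBoundedFDeriv (t₀ : ℝ) (f : ℝ → X → X) : Prop where
  differentiable : ∀ t, t₀ ≤ t → Differentiable ℝ (f t)
  bounded : ∀ (t₁ : ℝ) (C : Set X), IsCompact C →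
    ∃ L : ℝ, ∀ t ∈ Icc t₀ t₁, ∀ x ∈ C, ‖fderiv ℝ (f t) x‖ ≤ L

theorem IsRegular.hasLocallyBoundedFDeriv (hf : IsRegular t₀ f) : HasLocallyBoundedFDeriv t₀ f :=
  ⟨fun t ht => (hf.contDiff t ht).differentiable one_ne_zero, hf.bounded_fderiv⟩

theorem IsSolution.map_initial {x : X} {φ : ℝ → X} (hφ : IsSolution f t₀ x φ) : φ t₀ = x := by
  simpa using (hφ.2 t₀ le_rfl).2

theorem IsSolution.intervalIntegrable {x : X} {φ : ℝ → X} (hφ : IsSolution f t₀ x φ) {a b : ℝ}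
    (ha : t₀ ≤ a) (hb : t₀ ≤ b) :
    IntervalIntegrable (fun s => f s (φ s)) MeasureTheory.volume a b :=
  (hφ.2 a ha).1.symm.trans (hφ.2 b hb).1

theorem IsSolution.eq_add_integral {x : X} {φ : ℝ → X} (hφ : IsSolution f t₀ x φ) {a t : ℝ}
    (ha : t₀ ≤ a) (ht : t₀ ≤ t) : φ t = φ a + ∫ s in a..t, f s (φ s) := by
  rw [(hφ.2 t ht).2, (hφ.2 a ha).2, add_assoc,
    intervalIntegral.integral_add_adjacent_intervals (hφ.2 a ha).1 (hφ.intervalIntegrable ha ht)]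

theorem isSolution_flow (hfc : IsForwardComplete f t₀) (x : X) :
    IsSolution f t₀ x (fun t => flow f t t₀ x) := by
  have hflow : (fun t => flow f t t₀ x) = (hfc x).choose := funext fun t => dif_pos (hfc x)
  rw [hflow]
  exact (hfc x).choose_spec

variable [FiniteDimensional ℝ X]

theorem IsSolution.seminorm_sub_le (hf : ∀ t, t₀ ≤ t → Differentiable ℝ (f t)) {x y : X}
    {φ ψ : ℝ → X} (hφ : IsSolution f t₀ x φ) (hψ : IsSolution f t₀ y ψ) (q : Seminorm ℝ X)
    {a b c : ℝ} (ha : t₀ ≤ a) (hab : a ≤ b)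
    (h : ∀ t ∈ Ioo a b, ∀ v ∈ segment ℝ (ψ t) (φ t),
      dirDeriv q (φ t - ψ t) (fderiv ℝ (f t) v (φ t - ψ t)) ≤ c * q (φ t - ψ t)) :
    q (φ b - ψ b) ≤ q (φ a - ψ a) * Real.exp (c * (b - a)) := by
  have hfφ {t : ℝ} (ht : a ≤ t) := hφ.intervalIntegrable ha (ha.trans ht)
  have hfψ {t : ℝ} (ht : a ≤ t) := hψ.intervalIntegrable ha (ha.trans ht)
  refine seminorm_add_integral_le q (δ := fun t => φ t - ψ t)
    (w := fun t => f t (φ t) - f t (ψ t)) hab ((hfφ hab).sub (hfψ hab)) (fun t ht => ?_)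
    fun t ht => dirDeriv_image_sub_le q (hf t (ha.trans ht.1.le)) (h t ht)
  have hφt := hφ.eq_add_integral ha (ha.trans ht.1)
  have hψt := hψ.eq_add_integral ha (ha.trans ht.1)
  rw [hφt, hψt, intervalIntegral.integral_sub (hfφ ht.1) (hfψ ht.1)]
  abel

theorem IsSolution.norm_sub_le (hf : ∀ t, t₀ ≤ t → Differentiable ℝ (f t)) {x y : X}
    {φ ψ : ℝ → X} (hφ : IsSolution f t₀ x φ) (hψ : IsSolution f t₀ y ψ) {b L : ℝ} (hb : t₀ ≤ b)
    (h : ∀ t ∈ Ioo t₀ b, ∀ v ∈ segment ℝ (ψ t) (φ t), ‖fderiv ℝ (f t) v‖ ≤ L) :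
    ‖φ b - ψ b‖ ≤ ‖x - y‖ * Real.exp (L * (b - t₀)) := by
  rw [← hφ.map_initial, ← hψ.map_initial]
  refine hφ.seminorm_sub_le hf hψ (normSeminorm ℝ X) le_rfl hb fun t ht v hv => ?_
  exact (dirDeriv_le _ _ _).trans ((fderiv ℝ (f t) v).le_of_opNorm_le (h t ht v hv) _)

theorem IsSolution.exists_forall_norm_sub_le_one (hf : HasLocallyBoundedFDeriv t₀ f) {x : X}
    {φ : ℝ → X} (hφ : IsSolution f t₀ x φ) (T : ℝ) :
    ∃ ρ > 0, ∀ y ψ, IsSolution f t₀ y ψ → ‖y - x‖ < ρ → ∀ t ∈ Icc t₀ T, ‖ψ t - φ t‖ ≤ 1 := by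
  have hC : IsCompact (Metric.cthickening 1 (φ '' Icc t₀ T)) :=
    (isCompact_Icc.image_of_continuousOn (hφ.1.mono Icc_subset_Ici_self)).cthickening
  obtain ⟨L, hL⟩ := hf.bounded T _ hC
  refine ⟨Real.exp (-(|L| * (T - t₀))), Real.exp_pos _, fun y ψ hψ hyx t ht => ?_⟩
  by_contra! hlt
  -- the first time `s` at which `ψ` leaves the unit tube around `φ`
  have hcont : ContinuousOn (fun s => ‖ψ s - φ s‖) (Icc t₀ t) :=
    ((hψ.1.sub hφ.1).mono Icc_subset_Ici_self).norm
  have hexit : IsCompact (Icc t₀ t ∩ (fun s => ‖ψ s - φ s‖) ⁻¹' Ici 1) :=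
    isCompact_Icc.of_isClosed_subset (hcont.preimage_isClosed_of_isClosed isClosed_Icc isClosed_Ici)
      inter_subset_left
  obtain ⟨s, ⟨hs, hs1⟩, hmin⟩ := hexit.exists_isLeast ⟨t, right_mem_Icc.2 ht.1, hlt.le⟩
  have hinside (r : ℝ) (hr : r ∈ Ioo t₀ s) : ‖ψ r - φ r‖ ≤ 1 := by
    by_contra! h
    exact (hmin ⟨⟨hr.1.le, hr.2.le.trans hs.2⟩, h.le⟩).not_gt hr.2
  have hsT : s ≤ T := hs.2.trans ht.2
  have hbound := hψ.norm_sub_le hf.differentiable hφ (L := |L|) hs.1 fun r hr v hv => by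
    have hrT : r ∈ Icc t₀ T := ⟨hr.1.le, hr.2.le.trans hsT⟩
    have hball : v ∈ Metric.closedBall (φ r) 1 :=
      (convex_closedBall _ _).segment_subset (Metric.mem_closedBall_self zero_le_one)
        (mem_closedBall_iff_norm.2 (hinside r hr)) hv
    exact (hL r hrT v (Metric.closedBall_subset_cthickening (mem_image_of_mem φ hrT) 1 hball)).trans
      (le_abs_self L)
  have hsmall : ‖y - x‖ * Real.exp (|L| * (s - t₀)) < 1 :=
    calc ‖y - x‖ * Real.exp (|L| * (s - t₀))
        ≤ ‖y - x‖ * Real.exp (|L| * (T - t₀)) := by gcongr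
      _ < Real.exp (-(|L| * (T - t₀))) * Real.exp (|L| * (T - t₀)) := by gcongr
      _ = 1 := by rw [← Real.exp_add, neg_add_cancel, Real.exp_zero]
  exact (hs1.trans hbound).not_gt hsmall

theorem exists_norm_flow_le (hf : HasLocallyBoundedFDeriv t₀ f) (hfc : IsForwardComplete f t₀)
    {K : Set X} (hK : Bornology.IsBounded K) (T : ℝ) :
    ∃ R : ℝ, ∀ x ∈ K, ∀ t ∈ Icc t₀ T, ‖flow f t t₀ x‖ ≤ R := by
  suffices ∃ R : ℝ, ∀ x ∈ closure K, ∀ t ∈ Icc t₀ T, ‖flow f t t₀ x‖ ≤ R by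
    obtain ⟨R, hR⟩ := this
    exact ⟨R, fun x hx => hR x (subset_closure hx)⟩
  refine hK.isCompact_closure.induction_on
    (p := fun s => ∃ R : ℝ, ∀ x ∈ s, ∀ t ∈ Icc t₀ T, ‖flow f t t₀ x‖ ≤ R)
    ⟨0, by simp⟩ (fun s u hsu ⟨R, hR⟩ => ⟨R, fun x hx => hR x (hsu hx)⟩) ?_ fun x _ => ?_
  · rintro s u ⟨R, hR⟩ ⟨R', hR'⟩
    refine ⟨max R R', ?_⟩
    rintro x (hx | hx) t ht
    · exact (hR x hx t ht).trans (le_max_left _ _)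
    · exact (hR' x hx t ht).trans (le_max_right _ _)
  · have hξ := isSolution_flow hfc x
    obtain ⟨ρ, hρ, htube⟩ := hξ.exists_forall_norm_sub_le_one hf T
    obtain ⟨R, hR⟩ := isCompact_Icc.exists_bound_of_continuousOn (hξ.1.mono Icc_subset_Ici_self)
    refine ⟨Metric.ball x ρ, mem_nhdsWithin_of_mem_nhds (Metric.ball_mem_nhds x hρ), 1 + R, ?_⟩
    intro y hy t ht
    calc ‖flow f t t₀ y‖ ≤ ‖flow f t t₀ y - flow f t t₀ x‖ + ‖flow f t t₀ x‖ :=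
          norm_le_norm_sub_add _ _
      _ ≤ 1 + R :=
          add_le_add (htube y _ (isSolution_flow hfc y) (mem_ball_iff_norm.1 hy) t ht) (hR t ht)

theorem exists_norm_flow_sub_le (hf : HasLocallyBoundedFDeriv t₀ f)
    (hfc : IsForwardComplete f t₀) {K : Set X} (hK : Bornology.IsBounded K) (T : ℝ) :
    ∃ C > 0, ∀ x ∈ K, ∀ y ∈ K, ∀ t ∈ Icc t₀ T,
      ‖flow f t t₀ x - flow f t t₀ y‖ ≤ C * ‖x - y‖ := by
  obtain ⟨R, hR⟩ := exists_norm_flow_le hf hfc hK T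
  obtain ⟨L, hL⟩ := hf.bounded T _ (isCompact_closedBall (0 : X) R)
  refine ⟨Real.exp (|L| * (T - t₀)), Real.exp_pos _, fun x hx y hy t ht => ?_⟩
  have hmem (z : X) (hz : z ∈ K) (r : ℝ) (hr : r ∈ Icc t₀ T) :
      flow f r t₀ z ∈ Metric.closedBall 0 R := mem_closedBall_zero_iff.2 (hR z hz r hr)
  calc ‖flow f t t₀ x - flow f t t₀ y‖ ≤ ‖x - y‖ * Real.exp (|L| * (t - t₀)) := by
        refine (isSolution_flow hfc x).norm_sub_le hf.differentiable (isSolution_flow hfc y) ht.1 ?_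
        intro r hr v hv
        have hrT : r ∈ Icc t₀ T := ⟨hr.1.le, hr.2.le.trans ht.2⟩
        have hball := (convex_closedBall _ _).segment_subset (hmem y hy r hrT) (hmem x hx r hrT) hv
        exact (hL r hrT v hball).trans (le_abs_self L)
    _ ≤ Real.exp (|L| * (T - t₀)) * ‖x - y‖ := by
        rw [mul_comm]
        gcongr
        exact ht.2

end Flow

section NetworkNorm

theorem le_inducedNorm_mul {k l : ℕ} {p : Seminorm ℝ (Fin l → ℝ)} (hp : IsNorm p)
    (q : Seminorm ℝ (Fin k → ℝ)) (A : Matrix (Fin k) (Fin l) ℝ) (v : Fin l → ℝ) :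
    q (A.mulVec v) ≤ inducedNorm p q A * p v := by
  rcases eq_or_ne v 0 with rfl | hv
  · simp
  have hpv : 0 < p v := (apply_nonneg p v).lt_of_ne' fun h => hv (hp v h)
  have hunit : p ((p v)⁻¹ • v) = 1 := by
    rw [map_smul_eq_mul, norm_inv, Real.norm_of_nonneg hpv.le, inv_mul_cancel₀ hpv.ne']
  have h : q (A.mulVec ((p v)⁻¹ • v)) ≤ inducedNorm p q A :=
    le_csSup (bddAbove_inducedNorm hp q A) ⟨_, hunit, rfl⟩
  rwa [Matrix.mulVec_smul, map_smul_eq_mul, norm_inv, Real.norm_of_nonneg hpv.le,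
    inv_mul_le_iff₀' hpv] at h

theorem dirDeriv_mulVec_le {k : ℕ} (hk : 1 ≤ k) {p : Seminorm ℝ (Fin k → ℝ)} (hp : IsNorm p)
    (A : Matrix (Fin k) (Fin k) ℝ) (v : Fin k → ℝ) :
    dirDeriv p v (A.mulVec v) ≤ matrixMeasure p A * p v := by
  have hslope : Tendsto (fun s => (p (v + s • A.mulVec v) - p v) / s) (𝓝[>] 0)
      (𝓝 (dirDeriv p v (A.mulVec v))) := by
    simpa [slope_fun_def_field] using (hasDerivWithinAt_iff_tendsto_slope' (notMem_Ioi.2 le_rfl)).1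
      (hasDerivWithinAt_dirDeriv p v (A.mulVec v))
  refine le_of_tendsto_of_tendsto hslope ((tendsto_matrixMeasure hk hp A).mul_const (p v)) ?_
  filter_upwards [self_mem_nhdsWithin] with s (hs : 0 < s)
  calc (p (v + s • A.mulVec v) - p v) / s
      = (p ((1 + s • A).mulVec v) - p v) / s := by
        rw [Matrix.add_mulVec, Matrix.one_mulVec, Matrix.smul_mulVec]
    _ ≤ (inducedNorm p p (1 + s • A) * p v - p v) / s := by
        gcongr
        exact le_inducedNorm_mul hp p _ v
    _ = (inducedNorm p p (1 + s • A) - 1) / s * p v := by ring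

variable {m : ℕ} {n : Fin m → ℕ} {pL : (i : Fin m) → Seminorm ℝ (Fin (n i) → ℝ)}
  {pN : Seminorm ℝ (Fin m → ℝ)}

/-- The norm `|(|x_1|_1, …, |x_m|_m)|_N` on the state space. -/
def networkSeminorm (pL : (i : Fin m) → Seminorm ℝ (Fin (n i) → ℝ)) {pN : Seminorm ℝ (Fin m → ℝ)}
    (hmono : IsMonotone pN) : Seminorm ℝ (State n) :=
  Seminorm.of (fun x => pN fun i => pL i (x i))
    (fun x y => (hmono _ _ (fun i => add_nonneg (apply_nonneg _ _) (apply_nonneg _ _))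
      (fun i => apply_nonneg _ _) fun i => map_add_le_add (pL i) (x i) (y i)).trans
        (map_add_le_add pN (fun i => pL i (x i)) fun i => pL i (y i)))
    fun a x => by
      have hsmul : (fun i => pL i ((a • x) i)) = ‖a‖ • fun i => pL i (x i) :=
        funext fun i => map_smul_eq_mul (pL i) a (x i)
      rw [hsmul, map_smul_eq_mul, norm_norm]

theorem isNorm_networkSeminorm (hpL : ∀ i, IsNorm (pL i)) (hpN : IsNorm pN)
    (hmono : IsMonotone pN) : IsNorm (networkSeminorm pL hmono) :=
  fun _ hx => funext fun i => hpL i _ (congrFun (hpN _ hx) i)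

theorem dirDeriv_networkSeminorm_le (hmono : IsMonotone pN) {x w : State n} {a : Fin m → ℝ}
    (h : ∀ i, dirDeriv (pL i) (x i) (w i) ≤ a i) :
    dirDeriv (networkSeminorm pL hmono) x w ≤ dirDeriv pN (fun i => pL i (x i)) a := by
  let γ : ℝ → Fin m → ℝ := fun s i => pL i (x i + s • w i)
  let b : Fin m → ℝ := fun i => dirDeriv (pL i) (x i) (w i)
  have hγ₀ : γ 0 = fun i => pL i (x i) := by simp [γ]
  have hγ : HasDerivWithinAt γ b (Ioi 0) 0 :=
    hasDerivWithinAt_pi.2 fun i => hasDerivWithinAt_dirDeriv (pL i) (x i) (w i)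
  have hγ' : HasDerivWithinAt (fun s => γ s + s • (a - b)) a (Ioi 0) 0 := by
    simpa using hγ.fun_add ((hasDerivWithinAt_id (0 : ℝ) _).smul_const (a - b))
  have hderiv := hasDerivWithinAt_seminorm_comp pN hγ'
  rw [zero_smul, add_zero, hγ₀] at hderiv
  refine rightDeriv_le_of_eventually_le
    (hasDerivWithinAt_dirDeriv (networkSeminorm pL hmono) x w) hderiv
    (by simp only [zero_smul, add_zero, hγ₀]; rfl) ?_
  filter_upwards [self_mem_nhdsWithin] with s (hs : 0 < s)
  have hle : γ s ≤ γ s + s • (a - b) :=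
    le_add_of_nonneg_right (smul_nonneg hs.le (sub_nonneg.2 h))
  have hγs : 0 ≤ γ s := fun i => apply_nonneg (pL i) _
  exact hmono _ _ (hγs.trans hle) hγs hle

theorem fderiv_apply_eq_sum_jacobianBlock (f : ℝ → State n → State n) (t : ℝ) (v x : State n)
    (i : Fin m) : fderiv ℝ (f t) v x i = ∑ j, (jacobianBlock f t v i j).mulVec (x j) := by
  have hblock (j : Fin m) :
      (jacobianBlock f t v i j).mulVec (x j) = fderiv ℝ (f t) v (Pi.single j (x j)) i := by
    let L : (Fin (n j) → ℝ) →ₗ[ℝ] Fin (n i) → ℝ :=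
      LinearMap.proj i ∘ₗ (fderiv ℝ (f t) v).toLinearMap ∘ₗ
        LinearMap.single ℝ (fun j => Fin (n j) → ℝ) j
    exact LinearMap.toMatrix'_mulVec L (x j)
  simp_rw [hblock, ← Finset.sum_apply, ← map_sum, Finset.univ_sum_single]

theorem dirDeriv_fderiv_apply_le (hn : ∀ i, 1 ≤ n i) (hpL : ∀ i, IsNorm (pL i))
    (f : ℝ → State n → State n) (t : ℝ) (v x : State n) (i : Fin m) :
    dirDeriv (pL i) (x i) (fderiv ℝ (f t) v x i) ≤
      (interMatrix pL f t v).mulVec (fun j => pL j (x j)) i := by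
  let B := jacobianBlock f t v
  rw [fderiv_apply_eq_sum_jacobianBlock, Matrix.mulVec, dotProduct,
    ← Finset.add_sum_erase _ _ (Finset.mem_univ i), ← Finset.add_sum_erase _ _ (Finset.mem_univ i)]
  refine (dirDeriv_add_le _ _ _ _).trans (add_le_add ?_ ?_)
  · simpa [interMatrix] using dirDeriv_mulVec_le (hn i) (hpL i) (B i i) (x i)
  calc pL i (∑ j ∈ Finset.univ.erase i, (B i j).mulVec (x j))
      ≤ ∑ j ∈ Finset.univ.erase i, pL i ((B i j).mulVec (x j)) :=
        Finset.le_sum_of_subadditive (pL i) (map_zero (pL i)).le (map_add_le_add (pL i)) _ _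
    _ ≤ ∑ j ∈ Finset.univ.erase i, interMatrix pL f t v i j * pL j (x j) := by
        refine Finset.sum_le_sum fun j hj => ?_
        simpa [interMatrix, (Finset.ne_of_mem_erase hj).symm] using
          le_inducedNorm_mul (hpL j) (pL i) (B i j) (x j)

theorem dirDeriv_networkSeminorm_fderiv_le (hm : 1 ≤ m) (hn : ∀ i, 1 ≤ n i)
    (hpL : ∀ i, IsNorm (pL i)) (hpN : IsNorm pN) (hmono : IsMonotone pN)
    (f : ℝ → State n → State n) (t : ℝ) (v x : State n) :
    dirDeriv (networkSeminorm pL hmono) x (fderiv ℝ (f t) v x) ≤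
      matrixMeasure pN (interMatrix pL f t v) * networkSeminorm pL hmono x :=
  (dirDeriv_networkSeminorm_le hmono (dirDeriv_fderiv_apply_le hn hpL f t v x)).trans
    (dirDeriv_mulVec_le hm hpN _ _)

end NetworkNorm

section Covering

open MeasureTheory Metric Module

variable {X : Type*} [NormedAddCommGroup X] [NormedSpace ℝ X] [FiniteDimensional ℝ X]

theorem IsNorm.exists_norm_le {q : Seminorm ℝ X} (hq : IsNorm q) :
    ∃ C > 0, ∀ x, ‖x‖ ≤ C * q x := by
  obtain ⟨c, hc, hmin⟩ := (isCompact_sphere (0 : X) 1).exists_forall_le'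
    (continuous_seminorm q).continuousOn (a := 0) fun x hx =>
      (apply_nonneg q x).lt_of_ne' fun h => ne_of_mem_sphere hx one_ne_zero (hq x h)
  refine ⟨c⁻¹, inv_pos.2 hc, fun x => ?_⟩
  rcases eq_or_ne x 0 with rfl | hx
  · simp
  have hx0 : 0 < ‖x‖ := norm_pos_iff.2 hx
  have h : c ≤ q (‖x‖⁻¹ • x) := hmin _ (by simp [norm_smul, hx])
  rw [map_smul_eq_mul, norm_inv, norm_norm, le_inv_mul_iff₀ hx0] at h
  rwa [le_inv_mul_iff₀ hc, mul_comm]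

theorem card_le_of_pairwise_le_norm_sub {s : Finset X} {r R : ℝ} (hr : 0 < r) (hR : 0 ≤ R)
    (hs : ∀ x ∈ s, ‖x‖ ≤ R) (h : (s : Set X).Pairwise fun x y => r ≤ ‖x - y‖) :
    (s.card : ℝ) ≤ ((2 * R + r) / r) ^ finrank ℝ X := by
  -- compare the volume of the balls of radius `r / 2` about the points of `s`, which are disjoint,
  -- with that of the ball of radius `R + r / 2` about the origin
  borelize X
  let μ : Measure X := Measure.addHaar
  have hdisj : (s : Set X).Pairwise (Function.onFun Disjoint fun x => ball x (r / 2)) :=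
    fun x hx y hy hxy => ball_disjoint_ball <| by
      rw [add_halves, dist_eq_norm]
      exact h hx hy hxy
  have hsub : ⋃ x ∈ s, ball x (r / 2) ⊆ ball 0 (R + r / 2) :=
    iUnion₂_subset fun x hx => ball_subset_ball' <| by
      rw [dist_zero_right, add_comm]
      exact add_le_add_left (hs x hx) _
  have hvol : (s.card : ENNReal) * ENNReal.ofReal ((r / 2) ^ finrank ℝ X) * μ (ball 0 1) ≤
      ENNReal.ofReal ((R + r / 2) ^ finrank ℝ X) * μ (ball 0 1) :=
    calc (s.card : ENNReal) * ENNReal.ofReal ((r / 2) ^ finrank ℝ X) * μ (ball 0 1)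
        = μ (⋃ x ∈ s, ball x (r / 2)) := by
          simp only [measure_biUnion_finset hdisj fun _ _ => measurableSet_ball,
            μ.addHaar_ball_of_pos _ (half_pos hr), Finset.sum_const, nsmul_eq_mul, mul_assoc]
      _ ≤ μ (ball 0 (R + r / 2)) := measure_mono hsub
      _ = ENNReal.ofReal ((R + r / 2) ^ finrank ℝ X) * μ (ball 0 1) :=
          μ.addHaar_ball_of_pos _ (by positivity)
  rw [ENNReal.mul_le_mul_iff_left (measure_ball_pos _ _ one_pos).ne' measure_ball_lt_top.ne] at hvol
  have hreal := ENNReal.toReal_le_of_le_ofReal (by positivity) hvol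
  rw [ENNReal.toReal_mul, ENNReal.toReal_natCast, ENNReal.toReal_ofReal (by positivity)] at hreal
  calc (s.card : ℝ) ≤ (R + r / 2) ^ finrank ℝ X / (r / 2) ^ finrank ℝ X :=
        (le_div_iff₀ (by positivity)).2 hreal
    _ = ((2 * R + r) / r) ^ finrank ℝ X := by
        rw [← div_pow]
        congr 1
        field

theorem exists_finset_cover {K : Set X} (hK : Bornology.IsBounded K) :
    ∃ A > 0, ∀ r, 0 < r → r ≤ 1 → ∃ E : Finset X, ↑E ⊆ K ∧ (∀ y ∈ K, ∃ x ∈ E, ‖y - x‖ < r) ∧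
      (E.card : ℝ) ≤ (A / r) ^ finrank ℝ X := by
  obtain ⟨R, hR, hKR⟩ := hK.exists_pos_norm_le
  refine ⟨2 * R + 1, by positivity, fun r hr hr1 => ?_⟩
  let S : Set (Finset X) := {E | ↑E ⊆ K ∧ (E : Set X).Pairwise fun x y => r ≤ ‖x - y‖}
  have hcard {E : Finset X} (hE : E ∈ S) : (E.card : ℝ) ≤ ((2 * R + 1) / r) ^ finrank ℝ X :=
    calc (E.card : ℝ) ≤ ((2 * R + r) / r) ^ finrank ℝ X :=
          card_le_of_pairwise_le_norm_sub hr hR.le (fun x hx => hKR x (hE.1 hx)) hE.2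
      _ ≤ ((2 * R + 1) / r) ^ finrank ℝ X := by gcongr
  have hbdd : BddAbove (Finset.card '' S) := by
    refine ⟨⌊((2 * R + 1) / r) ^ finrank ℝ X⌋₊, ?_⟩
    rintro _ ⟨E, hE, rfl⟩
    exact Nat.le_floor (hcard hE)
  -- a separated set of maximal cardinality covers
  obtain ⟨_, ⟨E, hE, rfl⟩, hmax⟩ := hbdd.exists_isGreatest_of_nonempty ⟨0, ∅, by simp [S], rfl⟩
  refine ⟨E, hE.1, fun y hy => ?_, hcard hE⟩
  by_contra! hfar
  classical
  have hyE : y ∉ E := fun h => (hfar y h).not_gt (by simpa using hr)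
  have hinsert : insert y E ∈ S := by
    rw [mem_ofPred_eq, Finset.coe_insert]
    refine ⟨insert_subset hy hE.1, hE.2.insert fun x hx _ => ⟨hfar x hx, ?_⟩⟩
    rw [norm_sub_rev]
    exact hfar x hx
  have hle := hmax (mem_image_of_mem Finset.card hinsert)
  rw [Finset.card_insert_of_notMem hyE] at hle
  exact (Nat.lt_succ_self _).not_ge hle

end Covering

section EntropyBound

open Module

variable {X : Type*} [NormedAddCommGroup X] [NormedSpace ℝ X]
  {f : ℝ → X → X} {t₀ c : ℝ} {K : Set X}

theorem spanGrowth_le_of_spanNumber_le {p : Seminorm ℝ X} {ε B : ℝ} {N : ℕ} (hB : 0 < B)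
    (h : ∀ T, 0 ≤ T →
      (spanNumber p f t₀ ε T K : ENNReal) ≤ ENNReal.ofReal ((B * Real.exp (c * T)) ^ N)) :
    spanGrowth p f t₀ ε K ≤ ((N * c : ℝ) : EReal) := by
  have hlim : Tendsto (fun T : ℝ => ((N * Real.log B / T + N * c : ℝ) : EReal)) atTop
      (𝓝 ((N * c : ℝ) : EReal)) := by
    refine (continuous_coe_real_ereal.tendsto _).comp ?_
    simpa using (tendsto_const_nhds.div_atTop tendsto_id).add_const (N * c)
  refine le_of_le_of_eq (limsup_le_limsup ?_) hlim.limsup_eq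
  filter_upwards [eventually_gt_atTop 0] with T hT
  have hlog : Real.log ((B * Real.exp (c * T)) ^ N) = N * Real.log B + N * c * T := by
    rw [Real.log_pow, Real.log_mul hB.ne' (Real.exp_ne_zero _), Real.log_exp]
    ring
  have hspan := ENNReal.log_monotone (h T hT.le)
  rw [ENNReal.log_ofReal_of_pos (by positivity), hlog] at hspan
  refine (EReal.div_le_div_right_of_nonneg (by exact_mod_cast hT.le) hspan).trans_eq ?_
  rw [← EReal.coe_div, add_div, mul_div_cancel_right₀ _ hT.ne']

variable [FiniteDimensional ℝ X]

theorem exists_spanNumber_le (p : Seminorm ℝ X) (hK : Bornology.IsBounded K) (hc : 0 ≤ c) {C : ℝ}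
    (h : ∀ x ∈ K, ∀ y ∈ K, ∀ t, t₀ ≤ t →
      ‖flow f t t₀ x - flow f t t₀ y‖ ≤ C * Real.exp (c * (t - t₀)) * ‖x - y‖)
    {ε : ℝ} (hε : 0 < ε) :
    ∃ B > 0, ∀ T, 0 ≤ T → (spanNumber p f t₀ ε T K : ENNReal) ≤
      ENNReal.ofReal ((B * Real.exp (c * T)) ^ finrank ℝ X) := by
  obtain ⟨A, hA, hcover⟩ := exists_finset_cover hK
  obtain ⟨P, hP, hpP⟩ := exists_seminorm_le_mul_norm p
  let D : ℝ := max (P * C / ε) 1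
  have hD : 1 ≤ D := le_max_right _ _
  have hPC : P * C ≤ ε * D := (div_le_iff₀' hε).1 (le_max_left _ _)
  refine ⟨A * D, by positivity, fun T hT => ?_⟩
  have hDexp : 1 ≤ D * Real.exp (c * T) :=
    one_le_mul_of_one_le_of_one_le hD (Real.one_le_exp (mul_nonneg hc hT))
  obtain ⟨E, hEK, hE, hcard⟩ :=
    hcover (D * Real.exp (c * T))⁻¹ (by positivity) (inv_le_one_of_one_le₀ hDexp)
  have hspan : IsSpanning p f t₀ ε T K E := by
    refine ⟨hEK, fun y hy => ?_⟩
    obtain ⟨x, hx, hyx⟩ := hE y hy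
    refine ⟨x, hx, fun t ht => ?_⟩
    have htT : t - t₀ ≤ T := sub_le_iff_le_add'.2 ht.2
    calc p (flow f t t₀ y - flow f t t₀ x)
        ≤ P * ‖flow f t t₀ y - flow f t t₀ x‖ := hpP _
      _ ≤ P * (C * Real.exp (c * (t - t₀)) * ‖y - x‖) := by
          gcongr
          exact h y hy x (hEK hx) t ht.1
      _ = P * C * (Real.exp (c * (t - t₀)) * ‖y - x‖) := by ring
      _ ≤ ε * D * (Real.exp (c * T) * ‖y - x‖) := by gcongr
      _ < ε * D * (Real.exp (c * T) * (D * Real.exp (c * T))⁻¹) := by gcongr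
      _ = ε := by field
  calc (spanNumber p f t₀ ε T K : ENNReal) ≤ ((E.card : ℕ∞) : ENNReal) :=
        ENat.toENNReal_mono (iInf₂_le E hspan)
    _ = ENNReal.ofReal E.card := by simp
    _ ≤ ENNReal.ofReal ((A * D * Real.exp (c * T)) ^ finrank ℝ X) := by
        rw [div_inv_eq_mul, ← mul_assoc] at hcard
        exact ENNReal.ofReal_le_ofReal hcard

theorem entropy_le_of_norm_flow_sub_le (p : Seminorm ℝ X) (hK : Bornology.IsBounded K)
    (hc : 0 ≤ c) {C : ℝ} (h : ∀ x ∈ K, ∀ y ∈ K, ∀ t, t₀ ≤ t →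
      ‖flow f t t₀ x - flow f t t₀ y‖ ≤ C * Real.exp (c * (t - t₀)) * ‖x - y‖) :
    entropy p f t₀ K ≤ ((finrank ℝ X * c : ℝ) : EReal) := by
  refine iSup₂_le fun ε hε => ?_
  obtain ⟨B, hB, hspan⟩ := exists_spanNumber_le p hK hc h hε
  exact spanGrowth_le_of_spanNumber_le hB hspan

theorem exists_norm_flow_sub_le_exp (hf : HasLocallyBoundedFDeriv t₀ f)
    (hfc : IsForwardComplete f t₀) (hK : Bornology.IsBounded K) {q : Seminorm ℝ X}
    (hq : IsNorm q) (hc : 0 ≤ c) (h : ∀ᶠ t in atTop, ∀ v ∈ convexHull ℝ (reachableSet f t t₀ K),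
      ∀ w, dirDeriv q w (fderiv ℝ (f t) v w) ≤ c * q w) :
    ∃ C, ∀ x ∈ K, ∀ y ∈ K, ∀ t, t₀ ≤ t →
      ‖flow f t t₀ x - flow f t t₀ y‖ ≤ C * Real.exp (c * (t - t₀)) * ‖x - y‖ := by
  obtain ⟨T, hT₀, hT⟩ := ((eventually_ge_atTop t₀).and (eventually_forall_ge_atTop.2 h)).exists
  obtain ⟨C₀, hC₀, htransient⟩ := exists_norm_flow_sub_le hf hfc hK T
  obtain ⟨C₁, hC₁, hnorm⟩ := hq.exists_norm_le
  obtain ⟨C₂, hC₂, hqnorm⟩ := exists_seminorm_le_mul_norm q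
  refine ⟨max C₀ (C₁ * C₂ * C₀), fun x hx y hy t ht => ?_⟩
  rcases le_total t T with htT | hTt
  · have hexp : 1 ≤ Real.exp (c * (t - t₀)) := Real.one_le_exp (mul_nonneg hc (sub_nonneg.2 ht))
    calc ‖flow f t t₀ x - flow f t t₀ y‖ ≤ C₀ * 1 * ‖x - y‖ := by
          rw [mul_one]
          exact htransient x hx y hy t ⟨ht, htT⟩
      _ ≤ max C₀ (C₁ * C₂ * C₀) * Real.exp (c * (t - t₀)) * ‖x - y‖ := by
          gcongr
          exact le_max_left _ _
  have hgrowth := (isSolution_flow hfc x).seminorm_sub_le hf.differentiable (isSolution_flow hfc y)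
    q hT₀ hTt fun s hs v hv => hT s hs.1.le v ((convex_convexHull ℝ _).segment_subset
      (subset_convexHull ℝ _ (mem_image_of_mem _ hy))
      (subset_convexHull ℝ _ (mem_image_of_mem _ hx)) hv) _
  calc ‖flow f t t₀ x - flow f t t₀ y‖ ≤ C₁ * q (flow f t t₀ x - flow f t t₀ y) := hnorm _
    _ ≤ C₁ * (q (flow f T t₀ x - flow f T t₀ y) * Real.exp (c * (t - T))) := by gcongr
    _ ≤ C₁ * (C₂ * ‖flow f T t₀ x - flow f T t₀ y‖ * Real.exp (c * (t - t₀))) := by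
        gcongr
        exact hqnorm _
    _ ≤ C₁ * (C₂ * (C₀ * ‖x - y‖) * Real.exp (c * (t - t₀))) := by
        gcongr
        exact htransient x hx y hy T ⟨hT₀, le_rfl⟩
    _ = C₁ * C₂ * C₀ * Real.exp (c * (t - t₀)) * ‖x - y‖ := by ring
    _ ≤ max C₀ (C₁ * C₂ * C₀) * Real.exp (c * (t - t₀)) * ‖x - y‖ := by
        gcongr
        exact le_max_right _ _

theorem entropy_le_of_dirDeriv_le (p : Seminorm ℝ X) (hf : HasLocallyBoundedFDeriv t₀ f)
    (hfc : IsForwardComplete f t₀) (hK : Bornology.IsBounded K) {q : Seminorm ℝ X}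
    (hq : IsNorm q) (hc : 0 ≤ c) (h : ∀ᶠ t in atTop, ∀ v ∈ convexHull ℝ (reachableSet f t t₀ K),
      ∀ w, dirDeriv q w (fderiv ℝ (f t) v w) ≤ c * q w) :
    entropy p f t₀ K ≤ ((finrank ℝ X * c : ℝ) : EReal) := by
  obtain ⟨C, hC⟩ := exists_norm_flow_sub_le_exp hf hfc hK hq hc h
  exact entropy_le_of_norm_flow_sub_le p hK hc hC

end EntropyBound

theorem eventually_matrixMeasure_interMatrix_le {m : ℕ} {n : Fin m → ℕ}
    {pL : (i : Fin m) → Seminorm ℝ (Fin (n i) → ℝ)} {pN : Seminorm ℝ (Fin m → ℝ)}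
    {f : ℝ → State n → State n} {t₀ : ℝ} {K : Set (State n)} {c : ℝ}
    (hc : muHat pL pN f t₀ K < c) :
    ∀ᶠ t in atTop, ∀ v ∈ convexHull ℝ (reachableSet f t t₀ K),
      matrixMeasure pN (interMatrix pL f t v) ≤ c := by
  filter_upwards [eventually_lt_of_limsup_lt hc] with t ht v hv
  exact EReal.coe_le_coe_iff.1 ((le_iSup₂_of_le v hv le_rfl).trans ht.le)

end InterEntropy

end

open InterEntropy in
theorem corollary2_general {m : ℕ} (hm : 1 ≤ m) (n : Fin m → ℕ) (hn : ∀ i, 1 ≤ n i)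
    (pL : (i : Fin m) → Seminorm ℝ (Fin (n i) → ℝ)) (hpL : ∀ i, IsNorm (pL i))
    (pN : Seminorm ℝ (Fin m → ℝ)) (hpN : IsNorm pN) (hmono : IsMonotone pN)
    (t₀ : ℝ) (f : ℝ → State n → State n) (hf : HasLocallyBoundedFDeriv t₀ f)
    (hfc : IsForwardComplete f t₀) (K : Set (State n)) (hK : Bornology.IsBounded K)
    (p : Seminorm ℝ (State n)) :
    entropy p f t₀ K ≤ ((∑ i, n i : ℕ) : EReal) * max (muHat pL pN f t₀ K) 0 := by
  have hdim : Module.finrank ℝ (State n) = ∑ i, n i := by simp [Module.finrank_pi_fintype]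
  have hpos : 0 < ∑ i, n i :=
    Finset.sum_pos (fun i _ => hn i) (Finset.univ_nonempty_iff.2 ⟨⟨0, hm⟩⟩)
  rw [← EReal.div_le_iff_le_mul (by exact_mod_cast hpos) (EReal.natCast_ne_top _),
    ← EReal.le_of_forall_lt_iff_le]
  intro c hc
  obtain ⟨hμc, hc0⟩ := max_lt_iff.1 hc
  rw [EReal.div_le_iff_le_mul (by exact_mod_cast hpos) (EReal.natCast_ne_top _), ← hdim]
  refine entropy_le_of_dirDeriv_le p hf hfc hK (isNorm_networkSeminorm hpL hpN hmono)
    (EReal.coe_nonneg.1 hc0.le) ?_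
  filter_upwards [eventually_matrixMeasure_interMatrix_le hμc] with t ht v hv w
  exact (dirDeriv_networkSeminorm_fderiv_le hm hn hpL hpN hmono f t v w).trans
    (mul_le_mul_of_nonneg_right (ht v hv) (apply_nonneg _ _))

theorem corollary2 {m : ℕ} (hm : 1 ≤ m) (n : Fin m → ℕ) (hn : ∀ i, 1 ≤ n i)
    -- local norms on the spaces `ℝ^{n_i}` and a monotone network norm on `ℝ^m`
    (pL : (i : Fin m) → Seminorm ℝ (Fin (n i) → ℝ)) (hpL : ∀ i, InterEntropy.IsNorm (pL i))
    (pN : Seminorm ℝ (Fin m → ℝ)) (hpN : InterEntropy.IsNorm pN)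
    (hmono : InterEntropy.IsMonotone pN)
    -- the interconnected system
    (t₀ : ℝ) (f : ℝ → InterEntropy.State n → InterEntropy.State n)
    (hf : InterEntropy.IsRegular t₀ f) (hfc : InterEntropy.IsForwardComplete f t₀)
    -- the initial set
    (K : Set (InterEntropy.State n)) (hK : IsCompact K) (hKint : (interior K).Nonempty)
    -- the norm on the state space in the definition of entropy
    (p : Seminorm ℝ (InterEntropy.State n)) (hp : InterEntropy.IsNorm p) :
    InterEntropy.entropy p f t₀ K ≤
      ((∑ i, n i : ℕ) : EReal) * max (InterEntropy.muHat pL pN f t₀ K) 0 :=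
  corollary2_general hm n hn pL hpL pN hpN hmono t₀ f hf.hasLocallyBoundedFDeriv hfc K
    hK.isBounded p
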